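/- Let $H$ be a finite-dimensional complex Hilbert space, let $k$ be a positive integer with $\dim H > 2k$, and let $\mathcal{G}_k(H)$ be the set of all $k$-dimensional subspaces of $H$. Let $f : \mathcal{G}_k(H) \to \mathcal{G}_k(H)$ be a map (not assumed injective or surjective) that preserves orthogonality in both directions, i.e. for all $X, Y \in \mathcal{G}_k(H)$, $$X \perp Y \iff f(X) \perp f(Y).$$ Then $f$ is bijective, and it is induced by a unitary or anti-unitary operator: there is a unitary (surjective linear isometric) or anti-unitary (surjective conjugate-linear isometric) operator $U : H \to H$ such that $f(X) = U(X)$ for every $X \in \mathcal{G}_k(H)$. -/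

import Mathlib

/-- A transformation `f` of a set `X` preserves the relation `R` in both directions:
`x R y` if and only if `f x R f y`, for all `x` and `y`. -/
def PreservesInBothDirections {X : Type*} (R : X → X → Prop) (f : X → X) : Prop :=
  ∀ x y : X, R x y ↔ R (f x) (f y)

/-- The Grassmannian of all `k`-dimensional subspaces of a finite-dimensional complex
Hilbert space `H`. -/
def HilbertGrassmannian (k : ℕ) (H : Type*) [NormedAddCommGroup H] [InnerProductSpace ℂ H]
    [FiniteDimensional ℂ H] : Type _ :=
  {X : Submodule ℂ H // Module.finrank ℂ X = k}

namespace HilbertGrassmannian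

variable {k : ℕ} {H : Type*} [NormedAddCommGroup H] [InnerProductSpace ℂ H]
  [FiniteDimensional ℂ H]

/-- Two elements of the Grassmannian are orthogonal if they are orthogonal as subspaces, that is,
every vector of the first one is orthogonal to every vector of the second one. -/
def Orthogonal (X Y : HilbertGrassmannian k H) : Prop :=
  X.1 ⟂ Y.1

/-- The transformation `f` of the Grassmannian is induced by the map `T : H → H`:
it sends every `X` to the image `T(X)`. -/
def InducedBy (f : HilbertGrassmannian k H → HilbertGrassmannian k H) (T : H → H) : Prop :=
  ∀ X : HilbertGrassmannian k H, ((f X).1 : Set H) = T '' (X.1 : Set H)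

/-- `f` is induced by a unitary operator, i.e. a surjective linear isometry of `H`. -/
def InducedByUnitary (f : HilbertGrassmannian k H → HilbertGrassmannian k H) : Prop :=
  ∃ U : H ≃ₗᵢ[ℂ] H, InducedBy f U

/-- `f` is induced by an anti-unitary operator, i.e. a surjective conjugate-linear isometry
of `H`. -/
def InducedByAntiunitary (f : HilbertGrassmannian k H → HilbertGrassmannian k H) : Prop :=
  ∃ U : H ≃ₛₗᵢ[starRingEnd ℂ] H, InducedBy f U

end HilbertGrassmannian

/-! The problem is reduced to lines, where it becomes Uhlhorn's theorem. Orthogonality detects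
inclusion: if `T` is not contained in `S`, some `k`-space orthogonal to `S` is not orthogonal to a
`k`-space in `T`. Hence the span of the images of the `k`-spaces inside `S` grows strictly with `S`
(`finrank_spanImage_lt`). In dimension `dim H - k` the image of the complement of `S` caps this
span, and counting down from there shows that spans never exceed the dimension of `S`
(`finrank_spanImage_le`). So `dim H > 2 * k` leaves room to extend the map compatibly to `(k +
1)`-spaces, as an `IsGrassmannPair`. Such a pair at level `j + 1` yields one at level `j`
(`IsGrassmannPair.exists_pred`): the images of all spaces through a `j`-space `Y` share a `j`-space,
which is taken as the image of `Y`. At level 1 orthogonality is again preserved in both directions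
(`IsGrassmannPair.ortho_iff_of_one`). For lines, work in orthonormal coordinates. Ratios of image
coordinates depend only on the corresponding ratios of coordinates, so up to scalars the map is `v i
↦ c i * σ (v i)` with `σ` multiplicative. Orthogonality makes `σ` additive and compatible with
conjugation, so it is the identity or conjugation, and each `c i` has modulus 1. The resulting
isometry maps every `X` into its image, and `coe_eq_image` upgrades this to equality. -/

open Module

/-! ### Dimension counts for adjacent subspaces -/

section Dimension

variable {K V : Type*} [Field K] [AddCommGroup V] [Module K V]

theorem Submodule.exists_notMem_of_finrank_lt {S : Submodule K V} (h : finrank K S < finrank K V) :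
    ∃ v, v ∉ S := by
  by_contra! hc
  rw [(Submodule.eq_top_iff'.mpr hc), finrank_top] at h
  exact lt_irrefl _ h

variable [FiniteDimensional K V]

theorem Submodule.exists_between_finrank_eq {Y T : Submodule K V} (h : Y ≤ T) {m : ℕ}
    (hY : finrank K Y ≤ m) (hT : m ≤ finrank K T) :
    ∃ X, Y ≤ X ∧ X ≤ T ∧ finrank K X = m := by
  induction m, hY using Nat.le_induction with
  | base => exact ⟨Y, le_rfl, h, rfl⟩
  | succ m hm ih =>
    obtain ⟨X, hYX, hXT, hX⟩ := ih (by omega)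
    have : ∃ v ∈ T, v ∉ X := by
      by_contra! hc
      have := Submodule.finrank_mono (show T ≤ X from hc)
      omega
    obtain ⟨v, hvT, hvX⟩ := this
    refine ⟨X ⊔ span K {v}, le_trans hYX le_sup_left, sup_le hXT (by simpa using hvT), ?_⟩
    rw [finrank_sup_span_singleton hvX, hX]

theorem Submodule.inf_eq_and_finrank_sup_of_ne {Y X X' : Submodule K V}
    (hX : finrank K X = finrank K Y + 1) (hX' : finrank K X' = finrank K Y + 1)
    (hYX : Y ≤ X) (hYX' : Y ≤ X') (hne : X ≠ X') :
    X ⊓ X' = Y ∧ finrank K ↥(X ⊔ X') = finrank K Y + 2 := by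
  have h1 : finrank K ↥(X ⊓ X') < finrank K X := by
    refine Submodule.finrank_lt_finrank_of_lt (lt_of_le_of_ne inf_le_left fun h => hne ?_)
    exact Submodule.eq_of_le_of_finrank_eq (inf_eq_left.mp h) (by omega)
  have h2 : Y = X ⊓ X' := Submodule.eq_of_le_of_finrank_le (le_inf hYX hYX') (by omega)
  have h3 := Submodule.finrank_sup_add_finrank_inf_eq X X'
  rw [← h2] at h3
  exact ⟨h2.symm, by omega⟩

theorem Submodule.sup_eq_and_finrank_inf_of_ne {S X X' : Submodule K V} {d : ℕ}
    (hX : finrank K X = d) (hX' : finrank K X' = d) (hS : finrank K S = d + 1)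
    (hXS : X ≤ S) (hXS' : X' ≤ S) (hne : X ≠ X') :
    X ⊔ X' = S ∧ finrank K ↥(X ⊓ X') + 1 = d := by
  have h1 : finrank K X < finrank K ↥(X ⊔ X') := by
    refine Submodule.finrank_lt_finrank_of_lt (lt_of_le_of_ne le_sup_left fun h => hne ?_)
    exact (Submodule.eq_of_le_of_finrank_eq (left_eq_sup.mp h) (by omega)).symm
  have h2 : X ⊔ X' = S := Submodule.eq_of_le_of_finrank_le (sup_le hXS hXS') (by omega)
  have h3 := Submodule.finrank_sup_add_finrank_inf_eq X X'
  rw [h2] at h3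
  exact ⟨h2, by omega⟩

theorem Submodule.finrank_sup_of_not_le {S Y N : Submodule K V} (hY : finrank K Y = finrank K N + 1)
    (hNS : N ≤ S) (hNY : N ≤ Y) (hYS : ¬ Y ≤ S) : finrank K ↥(S ⊔ Y) = finrank K S + 1 := by
  have h1 : finrank K ↥(S ⊓ Y) < finrank K Y :=
    Submodule.finrank_lt_finrank_of_lt (lt_of_le_of_ne inf_le_right fun h => hYS (inf_eq_right.mp h))
  have h2 := Submodule.finrank_mono (le_inf hNS hNY)
  have h3 := Submodule.finrank_sup_add_finrank_inf_eq S Y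
  omega

/-- Three pairwise adjacent `d + 1`-dimensional subspaces that do not all lie in the span of two of
them have a common `d`-dimensional subspace. -/
theorem Submodule.inf_le_of_le_of_ne {X X' X'' S S₂ S₃ : Submodule K V} {d : ℕ}
    (e : finrank K X = d + 1) (e' : finrank K X' = d + 1) (e'' : finrank K X'' = d + 1)
    (d1 : finrank K S = d + 2) (d2 : finrank K S₂ = d + 2) (d3 : finrank K S₃ = d + 2)
    (m1 : X ≤ S) (m1' : X' ≤ S) (m2 : X ≤ S₂) (m2' : X'' ≤ S₂) (m3 : X' ≤ S₃) (m3' : X'' ≤ S₃)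
    (n1 : X ≠ X') (n2 : X ≠ X'') (n3 : X' ≠ X'') (hS : S ≠ S₂) :
    finrank K ↥(X ⊓ X') = d ∧ X ⊓ X' ≤ X'' := by
  -- As `S ⊓ S₂ = X`, the space `X''` is not inside `S`, so `S ⊓ X''` has dimension at most `d`. It
  -- contains the `d`-spaces `X ⊓ X''` and `X' ⊓ X''`, which therefore coincide and lie in `X ⊓ X'`.
  have hi := (Submodule.inf_eq_and_finrank_sup_of_ne (by omega) (by omega) m1 m2 hS).1
  have i1 := (Submodule.sup_eq_and_finrank_inf_of_ne e e' d1 m1 m1' n1).2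
  have i2 := (Submodule.sup_eq_and_finrank_inf_of_ne e e'' d2 m2 m2' n2).2
  have i3 := (Submodule.sup_eq_and_finrank_inf_of_ne e' e'' d3 m3 m3' n3).2
  have hnle' : ¬ X'' ≤ S := fun h =>
    n2 (Submodule.eq_of_le_of_finrank_eq ((le_inf h m2').trans hi.le) (by omega)).symm
  have hlt : finrank K ↥(S ⊓ X'') < finrank K X'' :=
    Submodule.finrank_lt_finrank_of_lt
      (lt_of_le_of_ne inf_le_right fun h => hnle' (inf_eq_right.mp h))
  have q2 : X ⊓ X'' = S ⊓ X'' :=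
    Submodule.eq_of_le_of_finrank_le (inf_le_inf_right _ m1) (by omega)
  have q3 : X' ⊓ X'' = S ⊓ X'' :=
    Submodule.eq_of_le_of_finrank_le (inf_le_inf_right _ m1') (by omega)
  have q : X ⊓ X'' = X ⊓ X' :=
    Submodule.eq_of_le_of_finrank_le
      (le_inf inf_le_left ((q2.trans q3.symm).le.trans inf_le_left)) (by omega)
  exact ⟨by omega, q ▸ inf_le_right⟩

end Dimension

/-! ### Descent from `(j + 1)`-spaces to `j`-spaces -/

section Descent

variable {H : Type*} [NormedAddCommGroup H] [InnerProductSpace ℂ H] [FiniteDimensional ℂ H]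

theorem Submodule.IsOrtho.exists_extend {X Y : Submodule ℂ H} (h : X ⟂ Y) {m : ℕ}
    (hX : finrank ℂ X ≤ m) (hY : finrank ℂ Y ≤ m) (hm : 2 * m ≤ finrank ℂ H) :
    ∃ X' Y' : Submodule ℂ H, X ≤ X' ∧ Y ≤ Y' ∧ finrank ℂ X' = m ∧ finrank ℂ Y' = m ∧
      X' ⟂ Y' := by
  have h1 := Y.finrank_add_finrank_orthogonal
  obtain ⟨X', hXX', hX'Y, hX'⟩ := Submodule.exists_between_finrank_eq h.le hX (by omega)
  have h2 := X'.finrank_add_finrank_orthogonal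
  obtain ⟨Y', hYY', hY'X', hY'⟩ :=
    Submodule.exists_between_finrank_eq (Submodule.IsOrtho.symm hX'Y).le hY (by omega)
  exact ⟨X', Y', hXX', hYY', hX', hY', Submodule.IsOrtho.symm hY'X'⟩

/-- A pair of maps defined on the `j`-dimensional and on the `(j + 1)`-dimensional subspaces,
compatible with inclusion, injective on adjacent subspaces, the first of which maps orthogonal
subspaces to orthogonal subspaces. -/
structure IsGrassmannPair (j : ℕ) (g g' : Submodule ℂ H → Submodule ℂ H) : Prop where
  finrank_left : ∀ X : Submodule ℂ H, finrank ℂ X = j → finrank ℂ (g X) = j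
  finrank_right : ∀ X : Submodule ℂ H, finrank ℂ X = j + 1 → finrank ℂ (g' X) = j + 1
  mono : ∀ X S : Submodule ℂ H, finrank ℂ X = j → finrank ℂ S = j + 1 → X ≤ S → g X ≤ g' S
  inj_left : ∀ X X' S : Submodule ℂ H, finrank ℂ X = j → finrank ℂ X' = j → finrank ℂ S = j + 1 →
    X ≤ S → X' ≤ S → g X = g X' → X = X'
  inj_right : ∀ X X' S : Submodule ℂ H, finrank ℂ X = j + 1 → finrank ℂ X' = j + 1 → finrank ℂ S = j + 2 →
    X ≤ S → X' ≤ S → g' X = g' X' → X = X'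
  ortho : ∀ X Y : Submodule ℂ H, finrank ℂ X = j → finrank ℂ Y = j → X ⟂ Y → g X ⟂ g Y

namespace IsGrassmannPair

variable {j : ℕ} {g g' : Submodule ℂ H → Submodule ℂ H}

/-- Adjacent spaces lie in a common space one dimension larger, so their images are equal or
adjacent. Joining `X` to `X'` by a chain of adjacent spaces shows that the codimension of the
intersection cannot increase. -/
theorem le_finrank_inf_add (hg : IsGrassmannPair j g g') (m : ℕ) {X X' : Submodule ℂ H}
    (hX : finrank ℂ X = j) (hX' : finrank ℂ X' = j) (hm : j ≤ finrank ℂ ↥(X ⊓ X') + m) :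
    j ≤ finrank ℂ ↥(g X ⊓ g X') + m := by
  induction m generalizing X with
  | zero =>
    have h1 : X ⊓ X' = X := Submodule.eq_of_le_of_finrank_le inf_le_left (by omega)
    have h2 : X = X' := Submodule.eq_of_le_of_finrank_le (inf_eq_left.mp h1) (by omega)
    subst h2
    rw [inf_idem, hg.finrank_left X hX]
    omega
  | succ m ih =>
    by_cases hle : X' ≤ X
    · have h2 : X' = X := Submodule.eq_of_le_of_finrank_le hle (by omega)
      subst h2
      rw [inf_idem, hg.finrank_left _ hX]
      omega
    obtain ⟨v, hvX', hvX⟩ := SetLike.not_le_iff_exists.mp hle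
    have h1 : finrank ℂ ↥(X ⊓ X') < j := by
      rw [← hX]
      refine Submodule.finrank_lt_finrank_of_lt (lt_of_le_of_ne inf_le_left fun h => hle ?_)
      exact (Submodule.eq_of_le_of_finrank_le (inf_eq_left.mp h) (by omega)).ge
    -- One step of the chain: replace `X` by `X1`, a hyperplane `Z` of `X` containing `X ⊓ X'`
    -- together with a vector of `X'` outside `X`.
    obtain ⟨Z, hZ1, hZX, hZ⟩ := Submodule.exists_between_finrank_eq
      (m := j - 1) (inf_le_left : X ⊓ X' ≤ X) (by omega) (by omega)
    have hX1 := Submodule.finrank_sup_span_singleton (K := ℂ) (fun h => hvX (hZX h))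
    set X1 := Z ⊔ Submodule.span ℂ {v} with hX1def
    have hX1' : finrank ℂ X1 = j := by omega
    have hvi : v ∉ X ⊓ X' := fun h => hvX h.1
    have h2 := Submodule.finrank_sup_span_singleton (K := ℂ) hvi
    have h3 : (X ⊓ X') ⊔ Submodule.span ℂ {v} ≤ X1 ⊓ X' :=
      sup_le (le_inf (hZ1.trans le_sup_left) inf_le_right)
        (le_inf le_sup_right (by simpa using hvX'))
    have h4 := Submodule.finrank_mono h3
    have h5 := ih hX1' (by omega)
    have hS := Submodule.finrank_sup_span_singleton (K := ℂ) hvX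
    have h6 := hg.mono X _ hX (by omega : finrank ℂ ↥(X ⊔ Submodule.span ℂ {v}) = j + 1) le_sup_left
    have h7 := hg.mono X1 _ hX1' (by omega : finrank ℂ ↥(X ⊔ Submodule.span ℂ {v}) = j + 1)
      (sup_le_sup_right hZX _)
    have h8 := hg.finrank_right _ (by omega : finrank ℂ ↥(X ⊔ Submodule.span ℂ {v}) = j + 1)
    have h9 := Submodule.finrank_sup_add_finrank_inf_eq (g X) (g X1)
    have h10 := Submodule.finrank_mono (sup_le h6 h7)
    have h11 := hg.finrank_left X hX
    have h12 := hg.finrank_left X1 hX1'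
    have h13 := Submodule.finrank_sup_add_finrank_inf_eq (g X ⊓ g X1) (g X1 ⊓ g X')
    have h14 := Submodule.finrank_mono
      (sup_le inf_le_right inf_le_left : (g X ⊓ g X1) ⊔ (g X1 ⊓ g X') ≤ g X1)
    have h15 := Submodule.finrank_mono
      (le_inf (inf_le_left.trans inf_le_left) (inf_le_right.trans inf_le_right) :
        (g X ⊓ g X1) ⊓ (g X1 ⊓ g X') ≤ g X ⊓ g X')
    omega

/-- The two joins `X ⊔ X'` and `X ⊔ X''` are distinct and adjacent, so `g'` separates them. The
images thus do not all lie in the span of two of them, which leaves only the configuration with a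
common `j`-space. -/
theorem inf_le_of_not_le_sup (hg : IsGrassmannPair (j + 1) g g') {Y X X' X'' : Submodule ℂ H}
    (hY : finrank ℂ Y = j) (hX : finrank ℂ X = j + 1) (hX' : finrank ℂ X' = j + 1)
    (hX'' : finrank ℂ X'' = j + 1) (hYX : Y ≤ X) (hYX' : Y ≤ X') (hYX'' : Y ≤ X'')
    (hne : X ≠ X') (hnle : ¬ X'' ≤ X ⊔ X') :
    finrank ℂ ↥(g X ⊓ g X') = j ∧ g X ⊓ g X' ≤ g X'' := by
  have hne1 : X ≠ X'' := fun h => hnle (h ▸ le_sup_left)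
  have hne2 : X' ≠ X'' := fun h => hnle (h ▸ le_sup_right)
  have hS1 := (Submodule.inf_eq_and_finrank_sup_of_ne (by omega) (by omega) hYX hYX' hne).2
  have hS2 := (Submodule.inf_eq_and_finrank_sup_of_ne (by omega) (by omega) hYX hYX'' hne1).2
  have hS3 := (Submodule.inf_eq_and_finrank_sup_of_ne (by omega) (by omega) hYX' hYX'' hne2).2
  rw [hY] at hS1 hS2 hS3
  have hT := Submodule.finrank_sup_of_not_le (by omega) (hYX.trans le_sup_left) hYX'' hnle
  have hS12 : g' (X ⊔ X') ≠ g' (X ⊔ X'') := fun h => by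
    have := hg.inj_right _ _ (X ⊔ X' ⊔ X'') hS1 hS2 (by omega) le_sup_left
      (sup_le (le_sup_left.trans le_sup_left) le_sup_right) h
    exact hnle (this ▸ le_sup_right)
  exact Submodule.inf_le_of_le_of_ne (hg.finrank_left _ hX) (hg.finrank_left _ hX')
    (hg.finrank_left _ hX'') (hg.finrank_right _ hS1) (hg.finrank_right _ hS2)
    (hg.finrank_right _ hS3) (hg.mono X _ hX hS1 le_sup_left) (hg.mono X' _ hX' hS1 le_sup_right)
    (hg.mono X _ hX hS2 le_sup_left) (hg.mono X'' _ hX'' hS2 le_sup_right)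
    (hg.mono X' _ hX' hS3 le_sup_left) (hg.mono X'' _ hX'' hS3 le_sup_right)
    (fun h => hne (hg.inj_left _ _ _ hX hX' hS1 le_sup_left le_sup_right h))
    (fun h => hne1 (hg.inj_left _ _ _ hX hX'' hS2 le_sup_left le_sup_right h))
    (fun h => hne2 (hg.inj_left _ _ _ hX' hX'' hS3 le_sup_left le_sup_right h)) hS12

theorem exists_le_of_finrank_eq (hg : IsGrassmannPair (j + 1) g g') (hn : j + 3 ≤ finrank ℂ H)
    {Y : Submodule ℂ H} (hY : finrank ℂ Y = j) :
    ∃ A : Submodule ℂ H, finrank ℂ A = j ∧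
      ∀ X : Submodule ℂ H, finrank ℂ X = j + 1 → Y ≤ X → A ≤ g X := by
  obtain ⟨v, hv⟩ := Submodule.exists_notMem_of_finrank_lt (S := Y) (by omega)
  have hX := Submodule.finrank_sup_span_singleton (K := ℂ) hv
  set X := Y ⊔ Submodule.span ℂ {v}
  obtain ⟨w, hw⟩ := Submodule.exists_notMem_of_finrank_lt (S := X) (by omega)
  have hX' := Submodule.finrank_sup_span_singleton (K := ℂ) (fun h => hw (le_sup_left (b := Submodule.span ℂ {v}) h) : w ∉ Y)
  set X' := Y ⊔ Submodule.span ℂ {w}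
  have hYX : Y ≤ X := le_sup_left
  have hYX' : Y ≤ X' := le_sup_left
  have hwX' : w ∈ X' := (le_sup_right : _ ≤ X') (Submodule.mem_span_singleton_self w)
  have hne : X ≠ X' := fun h => hw (h ▸ hwX')
  have hS := (Submodule.inf_eq_and_finrank_sup_of_ne (by omega) (by omega) hYX hYX' hne).2
  obtain ⟨u, hu⟩ := Submodule.exists_notMem_of_finrank_lt (S := X ⊔ X') (by omega)
  have hX3 := Submodule.finrank_sup_span_singleton (K := ℂ)
    (fun h => hu ((hYX.trans le_sup_left) h) : u ∉ Y)
  set X3 := Y ⊔ Submodule.span ℂ {u}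
  have hYX3 : Y ≤ X3 := le_sup_left
  have huX3 : u ∈ X3 := (le_sup_right : _ ≤ X3) (Submodule.mem_span_singleton_self u)
  have hX3S : ¬ X3 ≤ X ⊔ X' := fun h => hu (h huX3)
  obtain ⟨hA, hA3⟩ := hg.inf_le_of_not_le_sup hY (by omega) (by omega) (by omega) hYX hYX' hYX3
    hne hX3S
  refine ⟨g X ⊓ g X', hA, fun W hW hYW => ?_⟩
  -- If `W` lies in the span of `X` and `X'`, the auxiliary `X3` outside that span replaces `X'`:
  -- the candidate also lies in `g X ⊓ g X3`, and `W` is not in `X ⊔ X3`.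
  by_cases hWS : W ≤ X ⊔ X'
  · by_cases hWX : X = W
    · exact hWX ▸ inf_le_left
    have hXW := (Submodule.sup_eq_and_finrank_inf_of_ne (S := X ⊔ X') (by omega) hW (by omega)
      le_sup_left hWS hWX).1
    have hneX3 : X ≠ X3 := fun h => hX3S (h ▸ le_sup_left)
    have hS3 := (Submodule.inf_eq_and_finrank_sup_of_ne (by omega) (by omega) hYX hYX3 hneX3).2
    have hW3 : ¬ W ≤ X ⊔ X3 := fun h => by
      have : X ⊔ X' = X ⊔ X3 :=
        Submodule.eq_of_le_of_finrank_eq (hXW ▸ sup_le le_sup_left h) (by omega)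
      exact hX3S (this ▸ le_sup_right)
    exact (le_inf inf_le_left hA3).trans (hg.inf_le_of_not_le_sup hY (by omega) (by omega) hW
      hYX hYX3 hYW hneX3 hW3).2
  · exact (hg.inf_le_of_not_le_sup hY (by omega) (by omega) hW hYX hYX' hYW hne hWS).2

section Injectivity

variable {h : Submodule ℂ H → Submodule ℂ H}

/-- The images under `g` of `Y ⊔ Y''` and `Y' ⊔ Y''` are distinct and both contain `h Y = h Y'`, so
they meet exactly there. The image of `Y''` lies in both. -/
theorem apply_eq_of_not_le (hg : IsGrassmannPair (j + 1) g g')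
    (hfin : ∀ Y : Submodule ℂ H, finrank ℂ Y = j → finrank ℂ (h Y) = j)
    (hle : ∀ Y X : Submodule ℂ H, finrank ℂ Y = j → finrank ℂ X = j + 1 → Y ≤ X → h Y ≤ g X)
    {N Y Y' Y'' : Submodule ℂ H} (hN : finrank ℂ N + 1 = j)
    (hY : finrank ℂ Y = j) (hY' : finrank ℂ Y' = j) (hY'' : finrank ℂ Y'' = j)
    (hNY : N ≤ Y) (hNY' : N ≤ Y') (hNY'' : N ≤ Y'') (hne : Y ≠ Y') (hnle : ¬ Y'' ≤ Y ⊔ Y')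
    (heq : h Y = h Y') : h Y'' = h Y := by
  have hne1 : Y ≠ Y'' := fun h => hnle (h ▸ le_sup_left)
  have hne2 : Y' ≠ Y'' := fun h => hnle (h ▸ le_sup_right)
  have hS := (Submodule.inf_eq_and_finrank_sup_of_ne (by omega) (by omega) hNY hNY' hne).2
  have h1 := (Submodule.inf_eq_and_finrank_sup_of_ne (by omega) (by omega) hNY hNY'' hne1).2
  have h2 := (Submodule.inf_eq_and_finrank_sup_of_ne (by omega) (by omega) hNY' hNY'' hne2).2
  have hT := Submodule.finrank_sup_of_not_le (by omega) (hNY.trans le_sup_left) hNY'' hnle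
  have h12 : g (Y ⊔ Y'') ≠ g (Y' ⊔ Y'') := fun e => by
    have e1 := hg.inj_left _ _ (Y ⊔ Y' ⊔ Y'') (by omega) (by omega) (by omega)
      (sup_le_sup_right le_sup_left _) (sup_le_sup_right le_sup_right _) e
    have e2 : Y ⊔ Y' = Y ⊔ Y'' := Submodule.eq_of_le_of_finrank_eq
      (sup_le le_sup_left (e1 ▸ le_sup_left)) (by omega)
    exact hnle (e2 ▸ le_sup_right)
  have d1 := hg.finrank_left (Y ⊔ Y'') (by omega)
  have d2 := hg.finrank_left (Y' ⊔ Y'') (by omega)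
  have dY := hfin Y hY
  have dY'' := hfin Y'' hY''
  have hi := (Submodule.inf_eq_and_finrank_sup_of_ne (Y := h Y) (by omega) (by omega)
    (hle Y (Y ⊔ Y'') hY (by omega) le_sup_left)
    (heq ▸ hle Y' (Y' ⊔ Y'') hY' (by omega) le_sup_left) h12).1
  refine Submodule.eq_of_le_of_finrank_eq ?_ (by omega)
  rw [← hi]
  exact le_inf (hle _ _ hY'' (by omega) le_sup_right) (hle _ _ hY'' (by omega) le_sup_right)

theorem apply_eq_of_le (hg : IsGrassmannPair (j + 1) g g') (hn : j + 2 ≤ finrank ℂ H)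
    (hfin : ∀ Y : Submodule ℂ H, finrank ℂ Y = j → finrank ℂ (h Y) = j)
    (hle : ∀ Y X : Submodule ℂ H, finrank ℂ Y = j → finrank ℂ X = j + 1 → Y ≤ X → h Y ≤ g X)
    {N Y Y' Y'' : Submodule ℂ H} (hN : finrank ℂ N + 1 = j)
    (hY : finrank ℂ Y = j) (hY' : finrank ℂ Y' = j) (hY'' : finrank ℂ Y'' = j)
    (hNY : N ≤ Y) (hNY' : N ≤ Y') (hNY'' : N ≤ Y'') (hne : Y ≠ Y')
    (heq : h Y = h Y') : h Y'' = h Y := by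
  by_cases hS' : Y'' ≤ Y ⊔ Y'
  swap
  · exact hg.apply_eq_of_not_le hfin hle hN hY hY' hY'' hNY hNY' hNY'' hne hS' heq
  by_cases hYY : Y = Y''
  · rw [hYY]
  have hS := (Submodule.inf_eq_and_finrank_sup_of_ne (by omega) (by omega) hNY hNY' hne).2
  obtain ⟨u, hu⟩ := Submodule.exists_notMem_of_finrank_lt (S := Y ⊔ Y') (by omega)
  have hY3 := Submodule.finrank_sup_span_singleton (K := ℂ)
    (fun h => hu ((hNY.trans le_sup_left) h) : u ∉ N)
  set Y3 := N ⊔ Submodule.span ℂ {u}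
  have hNY3 : N ≤ Y3 := le_sup_left
  have huY3 : u ∈ Y3 := (le_sup_right : _ ≤ Y3) (Submodule.mem_span_singleton_self u)
  have hY3S : ¬ Y3 ≤ Y ⊔ Y' := fun h => hu (h huY3)
  have e3 := hg.apply_eq_of_not_le hfin hle hN hY hY' (by omega) hNY hNY' hNY3 hne hY3S heq
  have hne3 : Y ≠ Y3 := fun h => hY3S (h ▸ le_sup_left)
  have hS3 := (Submodule.inf_eq_and_finrank_sup_of_ne (by omega) (by omega) hNY hNY3 hne3).2
  have hYS := (Submodule.sup_eq_and_finrank_inf_of_ne (S := Y ⊔ Y') hY hY'' (by omega)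
      le_sup_left hS' hYY).1
  refine hg.apply_eq_of_not_le hfin hle hN hY (by omega) hY'' hNY hNY3 hNY'' hne3 (fun hc => ?_)
    e3.symm
  have : Y ⊔ Y' = Y ⊔ Y3 :=
    Submodule.eq_of_le_of_finrank_eq (hYS ▸ sup_le le_sup_left hc) (by omega)
  exact hY3S (this ▸ le_sup_right)

/-- A collision `h Y = h Y'` makes `h` constant on all `j`-spaces through `N = Y ⊓ Y'`, which forces
`h Y` into `g X` for every `X` through `N`. Orthogonality leaves too little room for this. -/
theorem apply_ne_of_ne (hg : IsGrassmannPair (j + 1) g g') (hj : 1 ≤ j)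
    (hn : 2 * (j + 1) ≤ finrank ℂ H)
    (hfin : ∀ Y : Submodule ℂ H, finrank ℂ Y = j → finrank ℂ (h Y) = j)
    (hle : ∀ Y X : Submodule ℂ H, finrank ℂ Y = j → finrank ℂ X = j + 1 → Y ≤ X → h Y ≤ g X)
    {Y Y' S : Submodule ℂ H} (hY : finrank ℂ Y = j) (hY' : finrank ℂ Y' = j)
    (hS : finrank ℂ S = j + 1) (hYS : Y ≤ S) (hYS' : Y' ≤ S) (hne : Y ≠ Y') : h Y ≠ h Y' := by
  intro heq
  have hN := (Submodule.sup_eq_and_finrank_inf_of_ne hY hY' hS hYS hYS' hne).2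
  set N := Y ⊓ Y'
  have key : ∀ X : Submodule ℂ H, finrank ℂ X = j + 1 → N ≤ X → h Y ≤ g X := by
    intro X hX hNX
    obtain ⟨Y'', h1, h2, h3⟩ := Submodule.exists_between_finrank_eq (m := j) hNX
      (by omega) (by omega)
    have := hg.apply_eq_of_le (by omega) hfin hle hN hY hY' h3 inf_le_left inf_le_right h1 hne heq
    exact this ▸ hle _ _ h3 hX h2
  obtain ⟨X, X'', hNX, -, hX, hX'', hort⟩ := (Submodule.isOrtho_bot_right :
    N ⟂ (⊥ : Submodule ℂ H)).exists_extend (m := j + 1) (by omega) (by simp) hn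
  -- `N ⊔ P` contains `N` and meets `X''` in dimension at least 2, hence so do the images `g (N ⊔
  -- P)` and `g X''`. That intersection is orthogonal to `h Y`, so `g (N ⊔ P)`, of dimension `j +
  -- 1`, would contain a direct sum of dimension at least `j + 2`.
  obtain ⟨P, -, hPX, hP⟩ := Submodule.exists_between_finrank_eq (m := 2)
    (bot_le : ⊥ ≤ X'') (by simp) (by omega)
  have hNP : N ⊓ P = ⊥ := (hort.mono hNX hPX).disjoint.eq_bot
  have hX' := Submodule.finrank_sup_add_finrank_inf_eq N P
  rw [hNP, finrank_bot] at hX'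
  have i1 := Submodule.finrank_mono (le_inf le_sup_right hPX : P ≤ (N ⊔ P) ⊓ X'')
  have i2 := hg.le_finrank_inf_add (j - 1) (X := N ⊔ P) (by omega) hX'' (by omega)
  have hdis : h Y ⊓ (g (N ⊔ P) ⊓ g X'') = ⊥ :=
    ((hg.ortho _ _ hX hX'' hort).mono (key X hX hNX) inf_le_right).disjoint.eq_bot
  have i3 := Submodule.finrank_sup_add_finrank_inf_eq (h Y) (g (N ⊔ P) ⊓ g X'')
  rw [hdis, finrank_bot] at i3
  have i4 := Submodule.finrank_mono
    (sup_le (key (N ⊔ P) (by omega) le_sup_left) inf_le_left :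
      h Y ⊔ (g (N ⊔ P) ⊓ g X'') ≤ g (N ⊔ P))
  have i5 := hg.finrank_left (N ⊔ P) (by omega)
  have i6 := hfin Y hY
  omega

end Injectivity

theorem exists_pred (hg : IsGrassmannPair (j + 1) g g') (hj : 1 ≤ j)
    (hn : 2 * (j + 1) ≤ finrank ℂ H) : ∃ h, IsGrassmannPair j h g := by
  have hex : ∀ Y : Submodule ℂ H, ∃ A : Submodule ℂ H, finrank ℂ Y = j → finrank ℂ A = j ∧
      ∀ X : Submodule ℂ H, finrank ℂ X = j + 1 → Y ≤ X → A ≤ g X := fun Y => by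
    by_cases hY : finrank ℂ Y = j
    · obtain ⟨A, hA⟩ := hg.exists_le_of_finrank_eq (by omega) hY
      exact ⟨A, fun _ => hA⟩
    · exact ⟨⊥, fun h => absurd h hY⟩
  choose h hh using hex
  refine ⟨h, fun X hX => (hh X hX).1, hg.finrank_left, fun X S hX hS hXS => (hh X hX).2 S hS hXS,
    fun X X' S hX hX' hS hXS hXS' heq => ?_, hg.inj_left, fun X Y hX hY hXY => ?_⟩
  · by_contra hne
    exact hg.apply_ne_of_ne hj hn (fun Y hY => (hh Y hY).1)
      (fun Y X hY hX hYX => (hh Y hY).2 X hX hYX) hX hX' hS hXS hXS' hne heq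
  · obtain ⟨X', Y', hXX', hYY', hX', hY', hort⟩ := hXY.exists_extend (m := j + 1)
      (by omega) (by omega) hn
    exact (hg.ortho _ _ hX' hY' hort).mono ((hh X hX).2 _ hX' hXX') ((hh Y hY).2 _ hY' hYY')

end IsGrassmannPair

end Descent

/-! ### Orthogonality-preserving maps in coordinates -/

section Coordinates

variable {ι : Type*} [DecidableEq ι]

open scoped ComplexConjugate

/-- The ratio functions satisfy the cocycle rule `ρ i l (s * t) = ρ i j s * ρ j l t`. Normalising
against coordinate `o` separates the constants `c i` from a single `σ`; the third index `b` makes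
`σ` multiplicative. -/
theorem exists_mul_of_coord_ratio {G : (ι → ℂ) → ι → ℂ}
    (hsupp : ∀ v, v ≠ 0 → ∀ i, G v i = 0 ↔ v i = 0) {ρ : ι → ι → ℂ → ℂ}
    (hρ : ∀ i j v, v j ≠ 0 → G v i = ρ i j (v i / v j) * G v j)
    {o a b : ι} (hoa : o ≠ a) (hob : o ≠ b) (hab : a ≠ b) :
    ∃ (σ : ℂ → ℂ) (c : ι → ℂ), σ 0 = 0 ∧ σ 1 = 1 ∧ (∀ s t, σ (s * t) = σ s * σ t) ∧ c o = 1 ∧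
      ∀ v, v ≠ 0 → ∃ l : ℂ, l ≠ 0 ∧ ∀ i, G v i = l * (c i * σ (v i)) := by
  have hcomp : ∀ i j l, i ≠ j → j ≠ l → i ≠ l → ∀ s t, t ≠ 0 →
      ρ i l (s * t) = ρ i j s * ρ j l t := by
    intro i j l hij hjl hil s t ht
    let v : ι → ℂ := fun k => if k = i then s * t else if k = j then t else if k = l then 1 else 0
    have hvi : v i = s * t := by simp [v]
    have hvj : v j = t := by simp [v, Ne.symm hij]
    have hvl : v l = 1 := by simp [v, Ne.symm hjl, Ne.symm hil]
    have hv0 : v ≠ 0 := fun h => by simp [h] at hvl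
    have h1 := hρ i j v (by rwa [hvj])
    have h2 := hρ j l v (by simp [hvl])
    have h3 := hρ i l v (by simp [hvl])
    have h4 : G v l ≠ 0 := by simp [hsupp v hv0, hvl]
    rw [hvi, hvj, mul_div_assoc, div_self ht, mul_one] at h1
    rw [hvj, hvl, div_one] at h2
    rw [hvi, hvl, div_one] at h3
    apply mul_right_cancel₀ h4
    rw [← h3, h1, h2, mul_assoc]
  have hpair : ∀ i j, i ≠ j → ∀ s, ∃ v : ι → ℂ, v ≠ 0 ∧ v i = s ∧ v j = 1 := by
    intro i j hij s
    have hj : (Pi.single i s + Pi.single j 1 : ι → ℂ) j = 1 := by simp [Ne.symm hij]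
    exact ⟨_, fun h => by rw [h] at hj; simp at hj, by simp [hij], hj⟩
  have hzero : ∀ i j, i ≠ j → ∀ s, ρ i j s = 0 ↔ s = 0 := by
    intro i j hij s
    obtain ⟨v, hv0, hvi, hvj⟩ := hpair i j hij s
    have h1 := hρ i j v (by simp [hvj])
    have h2 : G v j ≠ 0 := by simp [hsupp v hv0, hvj]
    rw [hvi, hvj, div_one] at h1
    rw [← hvi, ← hsupp v hv0, h1, hvi]
    simp [h2]
  have hinv : ∀ i j, i ≠ j → ∀ s, s ≠ 0 → ρ i j s * ρ j i s⁻¹ = 1 := by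
    intro i j hij s hs
    obtain ⟨v, hv0, hvi, hvj⟩ := hpair i j hij s
    have h1 := hρ i j v (by simp [hvj])
    have h3 := hρ j i v (by simpa [hvi])
    have h2 : G v j ≠ 0 := by simp [hsupp v hv0, hvj]
    rw [hvi, hvj, div_one] at h1
    rw [hvi, hvj, one_div] at h3
    apply mul_right_cancel₀ h2
    rw [one_mul]
    nth_rw 2 [h3]
    rw [h1]
    ring
  have hca : ρ a o 1 ≠ 0 := by simp [hzero a o hoa.symm]
  set c : ι → ℂ := fun i => if i = o then 1 else ρ i o 1 with hc
  set σ : ℂ → ℂ := fun s => ρ a o s / ρ a o 1 with hσ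
  have hco : c o = 1 := by simp [hc]
  have hcne : ∀ i, i ≠ o → c i = ρ i o 1 := fun i hi => by simp [hc, hi]
  have hc0 : ∀ i, c i ≠ 0 := fun i => by
    by_cases hi : i = o
    · simp [hi, hco]
    · simp [hcne i hi, hzero i o hi]
  have hσ0 : σ 0 = 0 := by simp [hσ, (hzero a o hoa.symm 0).mpr rfl]
  have hσ1 : σ 1 = 1 := by simp [hσ, hca]
  have hio : ∀ i, i ≠ o → ∀ s, ρ i o s = c i * σ s := by
    intro i hi s
    rw [hcne i hi]
    by_cases hs : s = 0
    · rw [hs, hσ0, mul_zero, hzero i o hi]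
    by_cases hia : i = a
    · simp only [hσ, hia]
      field_simp
    have h1 := hcomp i a o hia hoa.symm hi 1 s hs
    have h2 := hcomp i a o hia hoa.symm hi 1 1 one_ne_zero
    rw [one_mul] at h1 h2
    simp only [hσ]
    rw [h1, h2]
    field_simp
  have hij : ∀ i j, i ≠ o → j ≠ o → i ≠ j → ∀ s, ρ i j s * c j = c i * σ s := by
    intro i j hi hj hij s
    have h1 := hcomp i j o hij hj hi s 1 one_ne_zero
    rw [mul_one, hio i hi, hio j hj, hσ1, mul_one] at h1
    exact h1.symm
  have hmul : ∀ s t, σ (s * t) = σ s * σ t := by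
    intro s t
    by_cases ht : t = 0
    · simp [ht, hσ0]
    have h1 := hcomp b a o hab.symm hoa.symm hob.symm s t ht
    rw [hio b hob.symm, hio a hoa.symm] at h1
    have h2 := hij b a hob.symm hoa.symm hab.symm s
    apply mul_left_cancel₀ (hc0 b)
    linear_combination h1 + σ t * h2
  have hσne : ∀ s, s ≠ 0 → σ s ≠ 0 := fun s hs => by simp [hσ, hzero a o hoa.symm, hs]
  have hall : ∀ i j, i ≠ j → ∀ s, ρ i j s * c j = c i * σ s := by
    intro i j h s
    by_cases hs : s = 0
    · rw [hs, hσ0, (hzero i j h 0).mpr rfl]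
      simp
    by_cases hj : j = o
    · subst hj
      rw [hco, mul_one, hio i h]
    by_cases hi : i = o
    · subst hi
      have h1 := hinv i j h s hs
      rw [hio j h.symm] at h1
      have h2 := hmul s s⁻¹
      rw [mul_inv_cancel₀ hs, hσ1] at h2
      rw [hco]
      linear_combination (ρ i j s * c j) * h2 + σ s * h1
    · exact hij i j hi hj h s
  refine ⟨σ, c, hσ0, hσ1, hmul, hco, fun v hv => ?_⟩
  obtain ⟨j, hj⟩ := Function.ne_iff.mp hv
  have hj' : v j ≠ 0 := hj
  have hGj : G v j ≠ 0 := by rwa [Ne, hsupp v hv]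
  have hcσ := mul_ne_zero (hc0 j) (hσne _ hj')
  refine ⟨G v j / (c j * σ (v j)), div_ne_zero hGj hcσ, fun i => ?_⟩
  by_cases h : i = j
  · rw [h, div_mul_cancel₀ _ hcσ]
  have h1 := hρ i j v hj'
  have h2 := hall i j h (v i / v j)
  have h3 := hmul (v i / v j) (v j)
  rw [div_mul_cancel₀ _ hj'] at h3
  rw [h1, h3, div_mul_eq_mul_div, eq_div_iff hcσ]
  linear_combination (G v j * σ (v j)) * h2

variable [Fintype ι]

/-- A vector `a` supported on `{i, j}` and orthogonal to `v` depends only on `v i / v j`. Since `G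
a` has the same support, its orthogonality to `G v` fixes the ratio of the two coordinates of `G v`.
-/
theorem exists_coord_ratio {G : (ι → ℂ) → ι → ℂ}
    (hG : ∀ v w, v ≠ 0 → w ≠ 0 → star v ⬝ᵥ w = 0 → star (G v) ⬝ᵥ G w = 0)
    (hsupp : ∀ v, v ≠ 0 → ∀ i, G v i = 0 ↔ v i = 0) :
    ∃ ρ : ι → ι → ℂ → ℂ, ∀ i j v, v j ≠ 0 → G v i = ρ i j (v i / v j) * G v j := by
  refine ⟨fun i j t => if i = j then 1 else
    -conj (G (Pi.single i 1 + Pi.single j (-conj t)) j) /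
      conj (G (Pi.single i 1 + Pi.single j (-conj t)) i), fun i j v hv => ?_⟩
  by_cases hij : i = j
  · simp [hij]
  simp only [hij, if_false]
  set a : ι → ℂ := Pi.single i 1 + Pi.single j (-conj (v i / v j)) with ha
  have hai : a i = 1 := by simp [ha, hij]
  have haj : a j = -conj (v i / v j) := by simp [ha, Ne.symm hij]
  have hak : ∀ k, k ≠ i ∧ k ≠ j → a k = 0 := fun k hk => by simp [ha, hk.1, hk.2]
  have ha0 : a ≠ 0 := fun h => by simp [h] at hai
  have hv0 : v ≠ 0 := fun h => hv (by simp [h])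
  have hsum : ∀ u w : ι → ℂ, (∀ k, k ≠ i ∧ k ≠ j → u k = 0) →
      star u ⬝ᵥ w = conj (u i) * w i + conj (u j) * w j := fun u w hu => by
    rw [dotProduct, Fintype.sum_eq_add i j hij]
    · rfl
    · intro k hk
      simp [hu k hk]
  have h1 := hG a v ha0 hv0 (by
    rw [hsum a v hak, hai, haj]
    simp only [map_one, map_neg, Complex.conj_conj]
    field_simp
    ring)
  rw [hsum _ _ fun k hk => (hsupp a ha0 k).mpr (hak k hk)] at h1
  have h2 : conj (G a i) ≠ 0 := by
    rw [Ne, map_eq_zero, hsupp a ha0, hai]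
    exact one_ne_zero
  field_simp
  linear_combination h1

/-- A multiplicative map `σ` of `ℂ` such that `v ↦ (c i * σ (v i))` preserves orthogonality is
a field endomorphism commuting with conjugation. -/
theorem exists_ringHom_of_dotProduct {σ : ℂ → ℂ} {c : ι → ℂ} (hσ0 : σ 0 = 0) (hσ1 : σ 1 = 1)
    (hmul : ∀ s t, σ (s * t) = σ s * σ t) {o a b : ι} (hco : c o = 1)
    (hoa : o ≠ a) (hob : o ≠ b) (hab : a ≠ b)
    (hort : ∀ v w : ι → ℂ, v ≠ 0 → w ≠ 0 → star v ⬝ᵥ w = 0 →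
      ∑ i, conj (c i * σ (v i)) * (c i * σ (w i)) = 0) :
    ∃ τ : ℂ →+* ℂ, (∀ z, τ z = σ z) ∧ (∀ z, τ (conj z) = conj (τ z)) ∧ ∀ i, ‖c i‖ = 1 := by
  have hline : ∀ i, o ≠ i → ∀ x y, 1 + conj x * y = 0 →
      1 + conj (c i * σ x) * (c i * σ y) = 0 := by
    intro i hi x y hxy
    have hne : ∀ z, (Pi.single o 1 + Pi.single i z : ι → ℂ) ≠ 0 := fun z h => by
      have := congrFun h o
      simp [hi] at this
    have h1 := hort (Pi.single o 1 + Pi.single i x) (Pi.single o 1 + Pi.single i y)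
      (hne x) (hne y) (by
        rw [dotProduct, Fintype.sum_eq_add o i hi]
        · simpa [hi, hi.symm] using hxy
        · intro k hk
          simp [hk.1, hk.2])
    rw [Fintype.sum_eq_add o i hi] at h1
    · simpa [hi, hi.symm, hσ1, hco] using h1
    · intro k hk
      simp [hk.1, hk.2, hσ0]
  have hneg_sq : σ (-1) * σ (-1) = 1 := by rw [← hmul, neg_mul_neg, one_mul, hσ1]
  have hcn : ∀ i, o ≠ i → (Complex.normSq (c i) : ℂ) * σ (-1) = -1 := fun i hi => by
    have := hline i hi 1 (-1) (by simp)
    rw [hσ1, mul_one] at this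
    rw [Complex.normSq_eq_conj_mul_self]
    linear_combination this
  -- The alternative `σ (-1) = 1` would make the squared modulus of `c a` equal to `-1`.
  have hneg : σ (-1) = -1 := by
    rcases mul_self_eq_one_iff.mp hneg_sq with h | h
    · have h1 := hcn a hoa
      rw [h, mul_one] at h1
      have h2 : Complex.normSq (c a) = -1 := by exact_mod_cast h1
      have h3 := Complex.normSq_nonneg (c a)
      linarith
    · exact h
  have hcn1 : ∀ i, Complex.normSq (c i) = 1 := fun i => by
    by_cases hi : o = i
    · simp [← hi, hco]
    have h1 := hcn i hi
    rw [hneg] at h1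
    have h2 : (Complex.normSq (c i) : ℂ) = 1 := by linear_combination -h1
    exact_mod_cast h2
  have hcc : ∀ i, conj (c i) * c i = 1 := fun i => by
    rw [← Complex.normSq_eq_conj_mul_self, hcn1]
    simp
  have hconj : ∀ z, σ (conj z) = conj (σ z) := by
    intro z
    by_cases hz : z = 0
    · simp [hz, hσ0]
    have hz' : conj z ≠ 0 := by simpa using hz
    -- `(1, z)` is orthogonal to `(1, -1 / conj z)`.
    have h1 := hline a hoa z (-(conj z)⁻¹) (by field_simp; ring)
    have h2 := hmul (-(conj z)⁻¹) (conj z)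
    rw [neg_mul, inv_mul_cancel₀ hz', hneg] at h2
    rw [map_mul] at h1
    linear_combination σ (conj z) * h1 + conj (σ z) * h2 -
      σ (conj z) * conj (σ z) * σ (-(conj z)⁻¹) * hcc a
  -- Additivity comes from `(1, 1, 1)` being orthogonal to `(1, x, -(1 + x))`; this needs three
  -- coordinates.
  have hone : ∀ x, σ (1 + x) = 1 + σ x := by
    intro x
    let v : ι → ℂ := fun k => if k = o then 1 else if k = a then 1 else if k = b then 1 else 0
    let w : ι → ℂ := fun k =>
      if k = o then 1 else if k = a then x else if k = b then -1 * (1 + x) else 0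
    have hsum : ∀ F : ι → ℂ, (∀ k, k ≠ o → k ≠ a → k ≠ b → F k = 0) →
        ∑ k, F k = F o + F a + F b := fun F hF => by
      rw [← Finset.sum_subset (Finset.subset_univ {o, a, b})]
      · rw [Finset.sum_insert (by simp [hoa, hob]), Finset.sum_insert (by simp [hab]),
          Finset.sum_singleton, add_assoc]
      · intro k _ hk
        simp only [Finset.mem_insert, Finset.mem_singleton, not_or] at hk
        exact hF k hk.1 hk.2.1 hk.2.2
    have hv0 : v ≠ 0 := fun h => by simpa [v] using congrFun h o
    have hw0 : w ≠ 0 := fun h => by simpa [w] using congrFun h o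
    have h1 := hort v w hv0 hw0 (by
      rw [dotProduct, hsum]
      · simp [v, w, hoa.symm, hob.symm, hab.symm]
      · intro k h1 h2 h3
        simp [v, h1, h2, h3])
    rw [hsum] at h1
    · have hwb : w b = -1 * (1 + x) := by simp [w, hob.symm, hab.symm]
      have hwa : w a = x := by simp [w, hoa.symm]
      have hwo : w o = 1 := by simp [w]
      have hvb : v b = 1 := by simp [v]
      have hva : v a = 1 := by simp [v]
      have hvo : v o = 1 := by simp [v]
      rw [hwb, hwa, hwo, hvb, hva, hvo, hmul, hneg, hσ1] at h1
      simp only [mul_one] at h1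
      linear_combination -h1 + hcc o + σ x * hcc a - σ (1 + x) * hcc b
    · intro k h1 h2 h3
      simp [v, h1, h2, h3, hσ0]
  have hadd : ∀ x y, σ (x + y) = σ x + σ y := by
    intro x y
    by_cases hx : x = 0
    · simp [hx, hσ0]
    have h1 : x + y = x * (1 + y / x) := by field_simp
    rw [h1, hmul, hone, mul_add, mul_one, ← hmul, mul_div_cancel₀ _ hx]
  refine ⟨⟨⟨⟨σ, hσ1⟩, hmul⟩, hσ0, hadd⟩, fun _ => rfl, hconj, fun i => ?_⟩
  rw [Complex.norm_def, hcn1, Real.sqrt_one]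

end Coordinates

-- Commuting with conjugation, `τ` maps reals to reals, and the only ring endomorphism of `ℝ` is the
-- identity. So `τ` is an `ℝ`-algebra endomorphism of `ℂ`.
open scoped ComplexConjugate in
theorem Complex.ringHom_eq_id_or_conj_of_map_conj (τ : ℂ →+* ℂ)
    (hτ : ∀ z, τ (conj z) = conj (τ z)) : τ = RingHom.id ℂ ∨ τ = starRingEnd ℂ := by
  have hre : ∀ r : ℝ, ((τ r).re : ℂ) = τ r := fun r => by
    rw [← Complex.conj_eq_iff_re, ← hτ, Complex.conj_ofReal]
  let φ : ℝ →+* ℝ :=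
    { toFun := fun r => (τ r).re
      map_one' := by simp
      map_zero' := by simp
      map_mul' := fun r s => by
        have : (τ (r : ℂ) * τ (s : ℂ)) = (((τ r).re * (τ s).re : ℝ) : ℂ) := by
          rw [Complex.ofReal_mul, hre, hre]
        rw [Complex.ofReal_mul, map_mul, this, Complex.ofReal_re]
      map_add' := fun r s => by simp }
  have hφ : ∀ r : ℝ, τ r = r := fun r => by
    have : φ r = r := by rw [Subsingleton.elim φ (RingHom.id ℝ)]; rfl
    rw [← hre r]
    exact congrArg _ this
  let ψ : ℂ →ₐ[ℝ] ℂ := { τ with commutes' := hφ }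
  rcases Complex.real_algHom_eq_id_or_conj ψ with h | h
  · exact Or.inl (RingHom.ext fun z => DFunLike.congr_fun h z)
  · exact Or.inr (RingHom.ext fun z => DFunLike.congr_fun h z)

/-! ### Uhlhorn's theorem for lines -/

section Lines

variable {H : Type*} [NormedAddCommGroup H] [InnerProductSpace ℂ H] [FiniteDimensional ℂ H]

open scoped ComplexConjugate InnerProductSpace

theorem Orthonormal.exists_orthonormalBasis_of_card_eq {ι : Type*} [Fintype ι] {v : ι → H}
    (hv : Orthonormal ℂ v) (hcard : Fintype.card ι = finrank ℂ H) :
    ∃ b : OrthonormalBasis ι ℂ H, ∀ i, b i = v i :=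
  ⟨OrthonormalBasis.mk hv
    (hv.linearIndependent.span_eq_top_of_card_eq_finrank' hcard).ge, fun i => by simp⟩

/-- Coordinatewise complex conjugation. -/
noncomputable def EuclideanSpace.conjIsometry (ι : Type*) [Fintype ι] :
    EuclideanSpace ℂ ι ≃ₛₗᵢ[starRingEnd ℂ] EuclideanSpace ℂ ι where
  toFun x := WithLp.toLp 2 fun i => conj (x i)
  invFun x := WithLp.toLp 2 fun i => conj (x i)
  map_add' x y := by ext i; simp
  map_smul' a x := by ext i; simp
  left_inv x := by ext i; simp
  right_inv x := by ext i; simp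
  norm_map' x := by simp [EuclideanSpace.norm_eq]

theorem exists_coord_eq_of_inner_eq_zero_iff (hn : 3 ≤ finrank ℂ H) {F : H → H}
    (hF0 : ∀ v, v ≠ 0 → F v ≠ 0)
    (hF : ∀ v w, v ≠ 0 → w ≠ 0 → (⟪v, w⟫_ℂ = 0 ↔ ⟪F v, F w⟫_ℂ = 0)) :
    ∃ (b b' : OrthonormalBasis (Fin (finrank ℂ H)) ℂ H) (τ : ℂ →+* ℂ),
      (τ = RingHom.id ℂ ∨ τ = starRingEnd ℂ) ∧
      ∀ v, v ≠ 0 → ∃ l : ℂ, l ≠ 0 ∧ F v = l • ∑ i, τ ⟪b i, v⟫_ℂ • b' i := by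
  set e := stdOrthonormalBasis ℂ H
  have he0 : ∀ i, e i ≠ 0 := fun i => e.orthonormal.ne_zero i
  -- In the basis of normalised images of the `e i`, a coordinate of `F v` vanishes exactly when the
  -- same coordinate of `v` in `e` does.
  have hu : Orthonormal ℂ fun i => (‖F (e i)‖⁻¹ : ℂ) • F (e i) := by
    refine ⟨fun i => ?_, fun i j hij => ?_⟩
    · have := norm_ne_zero_iff.mpr (hF0 _ (he0 i))
      simp [norm_smul, this]
    · have h1 := (hF _ _ (he0 i) (he0 j)).mp (e.orthonormal.2 hij)
      simp [inner_smul_left, inner_smul_right, h1]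
  obtain ⟨u, hu'⟩ := hu.exists_orthonormalBasis_of_card_eq (by simp)
  have huF : ∀ i w, ⟪u i, w⟫_ℂ = 0 ↔ ⟪F (e i), w⟫_ℂ = 0 := fun i w => by
    rw [hu', inner_smul_left]
    have := norm_ne_zero_iff.mpr (hF0 _ (he0 i))
    simp [hF0 _ (he0 i)]
  set X : (Fin (finrank ℂ H) → ℂ) → H := fun x => ∑ i, x i • e i with hX
  have hXe : ∀ x i, ⟪e i, X x⟫_ℂ = x i := fun x i => e.orthonormal.inner_right_fintype x i
  have hX0 : ∀ x, x ≠ 0 → X x ≠ 0 := fun x hx h => hx (by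
    funext i
    rw [← hXe x i, h, inner_zero_right, Pi.zero_apply])
  have hXX : ∀ x y, ⟪X x, X y⟫_ℂ = star x ⬝ᵥ y := fun x y => e.orthonormal.inner_sum x y _
  have hXv : ∀ v, X (fun i => ⟪e i, v⟫_ℂ) = v := fun v => e.sum_repr' v
  set G : (Fin (finrank ℂ H) → ℂ) → Fin (finrank ℂ H) → ℂ := fun x i => ⟪u i, F (X x)⟫_ℂ with hG
  have hGG : ∀ x y, star (G x) ⬝ᵥ G y = ⟪F (X x), F (X y)⟫_ℂ := fun x y => by
    rw [← u.sum_inner_mul_inner]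
    simp [hG, dotProduct]
  have hsupp : ∀ x, x ≠ 0 → ∀ i, G x i = 0 ↔ x i = 0 := fun x hx i => by
    rw [hG, huF, ← hF _ _ (he0 i) (hX0 x hx), hXe]
  have hGort : ∀ x y, x ≠ 0 → y ≠ 0 → star x ⬝ᵥ y = 0 → star (G x) ⬝ᵥ G y = 0 :=
    fun x y hx hy h => by
      rw [hGG, ← hF _ _ (hX0 x hx) (hX0 y hy), hXX, h]
  obtain ⟨ρ, hρ⟩ := exists_coord_ratio hGort hsupp
  let o : Fin (finrank ℂ H) := ⟨0, by omega⟩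
  let a : Fin (finrank ℂ H) := ⟨1, by omega⟩
  let b : Fin (finrank ℂ H) := ⟨2, by omega⟩
  have hoa : o ≠ a := by simp [o, a]
  have hob : o ≠ b := by simp [o, b]
  have hab : a ≠ b := by simp [a, b]
  obtain ⟨σ, c, hσ0, hσ1, hmul, hco, hσ⟩ := exists_mul_of_coord_ratio hsupp hρ hoa hob hab
  obtain ⟨τ, hτσ, hτ, hc⟩ := exists_ringHom_of_dotProduct hσ0 hσ1 hmul hco hoa hob hab
    (fun v w hv hw hvw => by
      obtain ⟨l, hl, hlv⟩ := hσ v hv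
      obtain ⟨m, hm, hmw⟩ := hσ w hw
      have h1 := hGort v w hv hw hvw
      have h2 : star (G v) ⬝ᵥ G w =
          (conj l * m) * ∑ i, conj (c i * σ (v i)) * (c i * σ (w i)) := by
        rw [dotProduct, Finset.mul_sum]
        refine Finset.sum_congr rfl fun i _ => ?_
        rw [Pi.star_apply, hlv, hmw, ← starRingEnd_apply, map_mul]
        ring
      rw [h2] at h1
      exact (mul_eq_zero.mp h1).resolve_left (by simp [hl, hm]))
  -- The constants `c i` have modulus 1 and are absorbed into the target basis.
  have hb' : Orthonormal ℂ fun i => c i • u i := by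
    refine ⟨fun i => by simp [norm_smul, hc], fun i j hij => ?_⟩
    simp [inner_smul_left, inner_smul_right, u.orthonormal.2 hij]
  obtain ⟨b', hb'u⟩ := hb'.exists_orthonormalBasis_of_card_eq (by simp)
  refine ⟨e, b', τ, Complex.ringHom_eq_id_or_conj_of_map_conj τ hτ, fun v hv => ?_⟩
  obtain ⟨l, hl, hlv⟩ := hσ (fun i => ⟪e i, v⟫_ℂ) (fun h => hv (by
    rw [← hXv v, h]
    simp [hX]))
  refine ⟨l, hl, ?_⟩
  rw [← u.sum_repr' (F v), Finset.smul_sum]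
  refine Finset.sum_congr rfl fun i _ => ?_
  have h1 := hlv i
  simp only [hG, hXv] at h1
  rw [h1, hb'u, hτσ, smul_smul, smul_smul]
  congr 1
  ring

/-- Uhlhorn's theorem: a map of the lines of a Hilbert space of dimension at least three that
preserves orthogonality in both directions is induced by a unitary or anti-unitary operator. -/
theorem exists_isometry_of_line_map (hn : 3 ≤ finrank ℂ H) {g : Submodule ℂ H → Submodule ℂ H}
    (hfin : ∀ X : Submodule ℂ H, finrank ℂ X = 1 → finrank ℂ (g X) = 1)
    (hort : ∀ X Y : Submodule ℂ H, finrank ℂ X = 1 → finrank ℂ Y = 1 → (X ⟂ Y ↔ g X ⟂ g Y)) :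
    (∃ U : H ≃ₗᵢ[ℂ] H, ∀ v, v ≠ 0 → U v ∈ g (ℂ ∙ v)) ∨
      ∃ U : H ≃ₛₗᵢ[starRingEnd ℂ] H, ∀ v, v ≠ 0 → U v ∈ g (ℂ ∙ v) := by
  have hex : ∀ v : H, ∃ w : H, v ≠ 0 → w ≠ 0 ∧ g (ℂ ∙ v) = ℂ ∙ w := fun v => by
    by_cases hv : v = 0
    · exact ⟨0, fun h => absurd hv h⟩
    obtain ⟨⟨w, hw⟩, hw0', -⟩ := finrank_eq_one_iff'.mp (hfin _ (finrank_span_singleton hv))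
    have hw0 : w ≠ 0 := fun h => hw0' (Subtype.ext h)
    refine ⟨w, fun _ => ⟨hw0, Submodule.eq_of_le_of_finrank_eq ?_ ?_ |>.symm⟩⟩
    · simpa using hw
    · rw [hfin _ (finrank_span_singleton hv), finrank_span_singleton hw0]
  choose F hF using hex
  have hinner : ∀ v w : H, (ℂ ∙ v) ⟂ (ℂ ∙ w) ↔ ⟪v, w⟫_ℂ = 0 := fun v w => by
    simp [Submodule.isOrtho_span]
  obtain ⟨b, b', τ, hτ, h⟩ := exists_coord_eq_of_inner_eq_zero_iff hn (F := F)
    (fun v hv => (hF v hv).1) (fun v w hv hw => by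
      rw [← hinner, hort _ _ (finrank_span_singleton hv) (finrank_span_singleton hw),
        (hF v hv).2, (hF w hw).2, hinner])
  have hmem : ∀ v, v ≠ 0 → ∑ i, τ ⟪b i, v⟫_ℂ • b' i ∈ g (ℂ ∙ v) := fun v hv => by
    obtain ⟨l, hl, hlv⟩ := h v hv
    rw [(hF v hv).2, hlv]
    exact Submodule.mem_span_singleton.mpr ⟨l⁻¹, by rw [smul_smul, inv_mul_cancel₀ hl, one_smul]⟩
  rcases hτ with rfl | rfl
  · refine Or.inl ⟨b.repr.trans b'.repr.symm, fun v hv => ?_⟩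
    convert hmem v hv using 1
    simp [← b'.sum_repr_symm, b.repr_apply_apply]
  · refine Or.inr ⟨b.repr.trans ((EuclideanSpace.conjIsometry _).trans b'.repr.symm),
      fun v hv => ?_⟩
    convert hmem v hv using 1
    simp [← b'.sum_repr_symm, b.repr_apply_apply, EuclideanSpace.conjIsometry]

end Lines

/-! ### Extension to larger subspaces and reduction to lines -/

section Span

variable {H : Type*} [NormedAddCommGroup H] [InnerProductSpace ℂ H]

section

variable [FiniteDimensional ℂ H]

namespace IsGrassmannPair

/-- Inside the plane `X ⊔ Y`, let `Y'` be the orthogonal complement of `X`. If `g X ⟂ g Y`, both `g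
Y` and `g Y'` are the complement of `g X` in the image plane, so injectivity gives `Y = Y'`. -/
theorem ortho_iff_of_one {g g' : Submodule ℂ H → Submodule ℂ H} (hg : IsGrassmannPair 1 g g')
    {X Y : Submodule ℂ H} (hX : finrank ℂ X = 1) (hY : finrank ℂ Y = 1) :
    X ⟂ Y ↔ g X ⟂ g Y := by
  refine ⟨hg.ortho X Y hX hY, fun h => ?_⟩
  have hgX := hg.finrank_left X hX
  have hgY := hg.finrank_left Y hY
  have hne : X ≠ Y := by
    rintro rfl
    rw [Submodule.isOrtho_self.mp h, finrank_bot] at hgX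
    exact zero_ne_one hgX
  have hS := (Submodule.inf_eq_and_finrank_sup_of_ne (Y := ⊥) (by simpa) (by simpa)
    bot_le bot_le hne).2
  rw [finrank_bot, zero_add] at hS
  have hY' := Submodule.finrank_add_inf_finrank_orthogonal (le_sup_left : X ≤ X ⊔ Y)
  set Y' := Xᗮ ⊓ (X ⊔ Y)
  have hXY' : X ⟂ Y' := (Submodule.isOrtho_iff_le.mpr inf_le_left : Y' ⟂ X).symm
  have hd : finrank ℂ Y' = 1 := by omega
  have h' := hg.ortho X Y' hX hd hXY'
  have hgY' := hg.finrank_left Y' hd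
  have hl := hg.mono X _ hX hS le_sup_left
  have hd2 := Submodule.finrank_add_inf_finrank_orthogonal hl
  have hd3 := hg.finrank_right _ hS
  have e1 := Submodule.eq_of_le_of_finrank_eq
    (le_inf h.symm.le (hg.mono Y _ hY hS le_sup_right)) (by omega)
  have e2 := Submodule.eq_of_le_of_finrank_eq
    (le_inf h'.symm.le (hg.mono Y' _ hd hS inf_le_right)) (by omega)
  have := hg.inj_left Y Y' _ hY hd hS le_sup_right inf_le_right (e1.trans e2.symm)
  rwa [this]

end IsGrassmannPair

end

/-- A conjugate-linear isometry preserves the dimension of subspaces. -/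
theorem LinearIsometryEquiv.finrank_map_conj (U : H ≃ₛₗᵢ[starRingEnd ℂ] H)
    (X : Submodule ℂ H) : finrank ℂ (X.map (U.toLinearEquiv : H →ₛₗ[starRingEnd ℂ] H)) =
      finrank ℂ X := by
  have h := rank_eq_of_equiv_equiv (starRingEnd ℂ) (U.toLinearEquiv.submoduleMap X).toAddEquiv
    (starRingAut (R := ℂ)).bijective (fun r m => (U.toLinearEquiv.submoduleMap X).map_smulₛₗ r m)
  exact (congrArg Cardinal.toNat h).symm

/-- The span of the images of the `k`-dimensional subspaces of `S`. -/
def spanImage (k : ℕ) (φ : Submodule ℂ H → Submodule ℂ H) (S : Submodule ℂ H) : Submodule ℂ H :=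
  sSup (φ '' {X | finrank ℂ X = k ∧ X ≤ S})

variable {k : ℕ} {φ : Submodule ℂ H → Submodule ℂ H}

theorem le_spanImage {X S : Submodule ℂ H} (hX : finrank ℂ X = k) (hXS : X ≤ S) :
    φ X ≤ spanImage k φ S :=
  le_sSup ⟨X, ⟨hX, hXS⟩, rfl⟩

theorem spanImage_mono {S T : Submodule ℂ H} (h : S ≤ T) : spanImage k φ S ≤ spanImage k φ T :=
  sSup_le_sSup (Set.image_mono fun _ hX => ⟨hX.1, hX.2.trans h⟩)

theorem spanImage_eq [FiniteDimensional ℂ H] {X : Submodule ℂ H} (hX : finrank ℂ X = k) : spanImage k φ X = φ X := by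
  refine le_antisymm (sSup_le ?_) (le_spanImage hX le_rfl)
  rintro _ ⟨Y, ⟨hY, hYX⟩, rfl⟩
  rw [Submodule.eq_of_le_of_finrank_eq hYX (hY.trans hX.symm)]

section

variable (hort : ∀ X Y : Submodule ℂ H, finrank ℂ X = k → finrank ℂ Y = k → (X ⟂ Y ↔ φ X ⟂ φ Y))
include hort

theorem ortho_spanImage {Z S : Submodule ℂ H} (hZ : finrank ℂ Z = k) (h : Z ⟂ S) :
    φ Z ⟂ spanImage k φ S := by
  rw [spanImage, Submodule.isOrtho_sSup_right]
  rintro _ ⟨Y, ⟨hY, hYS⟩, rfl⟩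
  exact (hort Z Y hZ hY).mp (h.mono_right hYS)

variable [FiniteDimensional ℂ H]

theorem le_of_spanImage_le (hk : 1 ≤ k) {S T : Submodule ℂ H} (hT : k ≤ finrank ℂ T)
    (hS : finrank ℂ S + k ≤ finrank ℂ H) (h : spanImage k φ T ≤ spanImage k φ S) : T ≤ S := by
  by_contra hTS
  have h1 : ¬ Sᗮ ≤ Tᗮ := fun hc => hTS (by
    rw [← Submodule.orthogonal_orthogonal T, ← Submodule.orthogonal_orthogonal S]
    exact Submodule.orthogonal_le hc)
  -- A vector `z` orthogonal to `S` but not to some `t` in `T`; both are enlarged to `k`-spaces, `Z`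
  -- in `Sᗮ` and `X` in `T`, whose images would be orthogonal.
  obtain ⟨z, hzS, hzT⟩ := SetLike.not_le_iff_exists.mp h1
  rw [Submodule.mem_orthogonal] at hzT
  push Not at hzT
  obtain ⟨t, ht, hzt⟩ := hzT
  have hz1 : finrank ℂ (Submodule.span ℂ {z}) ≤ 1 := finrank_span_le_card _ |>.trans (by simp)
  have ht1 : finrank ℂ (Submodule.span ℂ {t}) ≤ 1 := finrank_span_le_card _ |>.trans (by simp)
  have hd := S.finrank_add_finrank_orthogonal
  obtain ⟨Z, hzZ, hZS, hZ⟩ := Submodule.exists_between_finrank_eq (m := k)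
    ((Submodule.span_singleton_le_iff_mem z _).mpr hzS) (by omega) (by omega)
  obtain ⟨X, htX, hXT, hX⟩ := Submodule.exists_between_finrank_eq (m := k)
    ((Submodule.span_singleton_le_iff_mem t _).mpr ht) (by omega) (by omega)
  have h2 : φ Z ⟂ φ X := (ortho_spanImage hort hZ (Submodule.isOrtho_iff_le.mpr hZS)).mono_right
    ((le_spanImage hX hXT).trans h)
  have h3 := (hort Z X hZ hX).mpr h2
  exact hzt (Submodule.isOrtho_iff_inner_eq.mp h3.symm t (htX (Submodule.mem_span_singleton_self t))
    z (hzZ (Submodule.mem_span_singleton_self z)))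

theorem finrank_spanImage_lt (hk : 1 ≤ k) {S T : Submodule ℂ H} (hS : k ≤ finrank ℂ S)
    (hS' : finrank ℂ S + k ≤ finrank ℂ H) (hST : S < T) :
    finrank ℂ (spanImage k φ S) < finrank ℂ (spanImage k φ T) :=
  Submodule.finrank_lt_finrank_of_lt (lt_of_le_not_ge (spanImage_mono hST.le) fun h =>
    hST.not_ge (le_of_spanImage_le hort hk (hS.trans (Submodule.finrank_mono hST.le)) hS' h))

/-- For `T v` in `φ X`, let `b` be the component of `v` orthogonal to `X`. Then `T b` lies in `φ X`
and also in the image of a `k`-space orthogonal to `X`, so it vanishes. Only additivity of `T`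
enters, so the linear and conjugate-linear cases are treated together. -/
theorem coe_eq_image (hk : 1 ≤ k) (hn : 2 * k < finrank ℂ H) {T : H → H}
    (hadd : ∀ x y, T (x + y) = T x + T y) (hsurj : Function.Surjective T)
    (hmem : ∀ X : Submodule ℂ H, finrank ℂ X = k → ∀ v ∈ X, T v ∈ φ X) {X : Submodule ℂ H}
    (hX : finrank ℂ X = k) : (φ X : Set H) = T '' X := by
  refine Set.Subset.antisymm (fun w hw => ?_) (Set.image_subset_iff.mpr (hmem X hX))
  obtain ⟨v, rfl⟩ := hsurj w
  obtain ⟨a, ha, b, hb, rfl⟩ := X.exists_add_mem_mem_orthogonal v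
  have h1 := X.finrank_add_finrank_orthogonal
  have hb1 : finrank ℂ (Submodule.span ℂ {b}) ≤ 1 := finrank_span_le_card _ |>.trans (by simp)
  obtain ⟨X', hbX', hX'X, hX'⟩ := Submodule.exists_between_finrank_eq (m := k)
    ((Submodule.span_singleton_le_iff_mem b _).mpr hb) (by omega) (by omega)
  have h2 := hmem X' hX' b (hbX' (Submodule.mem_span_singleton_self b))
  have h3 : T b ∈ φ X := by
    have := sub_mem hw (hmem X hX a ha)
    rwa [hadd, add_sub_cancel_left] at this
  have h4 := (hort X' X hX' hX).mp (Submodule.isOrtho_iff_le.mpr hX'X)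
  have h5 : T b = 0 := Submodule.disjoint_def.mp h4.disjoint _ h2 h3
  exact ⟨a, ha, by rw [hadd, h5, add_zero]⟩

variable (hfin : ∀ X : Submodule ℂ H, finrank ℂ X = k → finrank ℂ (φ X) = k)
include hfin

/-- Downward induction on the dimension of `S`, starting at `dim H - k`, where the span is
orthogonal to the `k`-dimensional `φ Sᗮ`. Each step down loses at least one dimension by strict
monotonicity. -/
theorem finrank_spanImage_le (hk : 1 ≤ k) (m : ℕ) {S : Submodule ℂ H} (hS : k ≤ finrank ℂ S)
    (hm : finrank ℂ S + m + k = finrank ℂ H) :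
    finrank ℂ (spanImage k φ S) + m + k ≤ finrank ℂ H := by
  induction m generalizing S with
  | zero =>
    have h1 := S.finrank_add_finrank_orthogonal
    have h2 := ortho_spanImage hort (Z := Sᗮ) (by omega) (Submodule.isOrtho_iff_le.mpr le_rfl)
    have h3 := hfin Sᗮ (by omega)
    have h4 := Submodule.finrank_mono h2.le
    have h5 := (spanImage k φ S).finrank_add_finrank_orthogonal
    omega
  | succ m ih =>
    obtain ⟨T, hST, -, hT⟩ := Submodule.exists_between_finrank_eq (m := finrank ℂ S + 1)
      (le_top : S ≤ ⊤) (by omega) (by rw [finrank_top]; omega)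
    have h1 := finrank_spanImage_lt hort hk hS (by omega)
      (lt_of_le_of_ne hST fun h => by rw [h] at hT; omega)
    have h2 := ih (S := T) (by omega) (by omega)
    omega

theorem isGrassmannPair_spanImage (hk : 1 ≤ k) (hn : 2 * k < finrank ℂ H) :
    IsGrassmannPair k φ (spanImage k φ) where
  finrank_left := hfin
  finrank_right S hS := by
    have h1 := finrank_spanImage_le hort hfin hk (finrank ℂ H - 2 * k - 1) (S := S)
      (by omega) (by omega)
    obtain ⟨X, -, hXS, hX⟩ := Submodule.exists_between_finrank_eq (m := k)
      (bot_le : ⊥ ≤ S) (by simp) (by omega)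
    have h2 := finrank_spanImage_lt hort hk (S := X) (T := S) (by omega) (by omega)
      (lt_of_le_of_ne hXS fun h => by rw [h] at hX; omega)
    rw [spanImage_eq hX, hfin X hX] at h2
    omega
  mono X S hX _ hXS := le_spanImage hX hXS
  inj_left X X' S hX hX' _ _ _ h := by
    rw [← spanImage_eq (φ := φ) hX, ← spanImage_eq (φ := φ) hX'] at h
    exact le_antisymm (le_of_spanImage_le hort hk (by omega) (by omega) h.le)
      (le_of_spanImage_le hort hk (by omega) (by omega) h.ge)
  inj_right X X' S hX hX' _ _ _ h :=
    le_antisymm (le_of_spanImage_le hort hk (by omega) (by omega) h.le)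
      (le_of_spanImage_le hort hk (by omega) (by omega) h.ge)
  ortho X Y hX hY := (hort X Y hX hY).mp

theorem exists_isGrassmannPair (hk : 1 ≤ k) (hn : 2 * k < finrank ℂ H) (d : ℕ) {j : ℕ}
    (hj : 1 ≤ j) (hjd : j + d = k) : ∃ g g' : Submodule ℂ H → Submodule ℂ H,
      IsGrassmannPair j g g' ∧
      ∀ Y X : Submodule ℂ H, finrank ℂ Y = j → finrank ℂ X = k → Y ≤ X → g Y ≤ φ X := by
  induction d generalizing j with
  | zero =>
    obtain rfl : j = k := hjd
    refine ⟨φ, _, isGrassmannPair_spanImage hort hfin hk hn, fun Y X hY hX hYX => ?_⟩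
    rw [Submodule.eq_of_le_of_finrank_eq hYX (hY.trans hX.symm)]
  | succ d ih =>
    obtain ⟨g, g', hg, hle⟩ := ih (j := j + 1) (by omega) (by omega)
    obtain ⟨h, hh⟩ := hg.exists_pred hj (by omega)
    refine ⟨h, g, hh, fun Y X hY hX hYX => ?_⟩
    obtain ⟨X', hYX', hXX', hX'⟩ := Submodule.exists_between_finrank_eq (m := j + 1) hYX
      (by omega) (by omega)
    exact (hh.mono _ _ hY hX' hYX').trans (hle _ _ hX' hX hXX')

theorem exists_isometry_of_grassmann_map (hk : 1 ≤ k) (hn : 2 * k < finrank ℂ H) :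
    (∃ U : H ≃ₗᵢ[ℂ] H, ∀ X : Submodule ℂ H, finrank ℂ X = k → ∀ v ∈ X, U v ∈ φ X) ∨
      ∃ U : H ≃ₛₗᵢ[starRingEnd ℂ] H, ∀ X : Submodule ℂ H, finrank ℂ X = k → ∀ v ∈ X, U v ∈ φ X := by
  obtain ⟨g, g', hg, hle⟩ := exists_isGrassmannPair hort hfin hk hn (k - 1) le_rfl (by omega)
  have hmem : ∀ T : H → H, T 0 = 0 → (∀ v, v ≠ 0 → T v ∈ g (Submodule.span ℂ {v})) →
      ∀ X : Submodule ℂ H, finrank ℂ X = k → ∀ v ∈ X, T v ∈ φ X := fun T hT0 hT X hX v hv => by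
    by_cases hv0 : v = 0
    · rw [hv0, hT0]
      exact zero_mem _
    · exact hle _ X (finrank_span_singleton hv0) hX
        ((Submodule.span_singleton_le_iff_mem v X).mpr hv) (hT v hv0)
  exact (exists_isometry_of_line_map (by omega) hg.finrank_left
    fun X Y hX hY => hg.ortho_iff_of_one hX hY).imp
    (fun ⟨U, hU⟩ => ⟨U, hmem U (map_zero U) hU⟩) (fun ⟨U, hU⟩ => ⟨U, hmem U (map_zero U) hU⟩)

end

end Span

/-! ### Bijectivity and the main theorem -/

namespace HilbertGrassmannian

variable {k : ℕ} {H : Type*} [NormedAddCommGroup H] [InnerProductSpace ℂ H]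
  [FiniteDimensional ℂ H] {f : HilbertGrassmannian k H → HilbertGrassmannian k H}

theorem InducedBy.injective {T : H → H} (h : InducedBy f T) (hT : Function.Injective T) :
    Function.Injective f := fun X Y hXY => by
  have h1 := (h X).symm.trans ((congrArg (fun Z => (Z.1 : Set H)) hXY).trans (h Y))
  exact Subtype.ext (SetLike.coe_injective (hT.image_injective h1))

theorem InducedBy.bijective_of_unitary {U : H ≃ₗᵢ[ℂ] H} (h : InducedBy f U) :
    Function.Bijective f := by
  refine ⟨h.injective U.injective, fun X => ?_⟩
  refine ⟨⟨X.1.map (U.symm.toLinearEquiv : H →ₗ[ℂ] H),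
    (LinearEquiv.finrank_map_eq _ _).trans X.2⟩, Subtype.ext (SetLike.coe_injective ?_)⟩
  refine (h _).trans ?_
  ext w
  simp

theorem InducedBy.bijective_of_antiunitary {U : H ≃ₛₗᵢ[starRingEnd ℂ] H} (h : InducedBy f U) :
    Function.Bijective f := by
  refine ⟨h.injective U.injective, fun X => ?_⟩
  refine ⟨⟨X.1.map (U.symm.toLinearEquiv : H →ₛₗ[starRingEnd ℂ] H),
    (U.symm.finrank_map_conj _).trans X.2⟩, Subtype.ext (SetLike.coe_injective ?_)⟩
  refine (h _).trans ?_
  ext w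
  simp

end HilbertGrassmannian

theorem theorem2 {H : Type*} [NormedAddCommGroup H] [InnerProductSpace ℂ H]
    [FiniteDimensional ℂ H] (k : ℕ) (hk : 2 * k < Module.finrank ℂ H)
    (f : HilbertGrassmannian k H → HilbertGrassmannian k H)
    (hf : PreservesInBothDirections HilbertGrassmannian.Orthogonal f) :
    Function.Bijective f ∧
      (HilbertGrassmannian.InducedByUnitary f ∨ HilbertGrassmannian.InducedByAntiunitary f) := by
  suffices h : HilbertGrassmannian.InducedByUnitary f ∨
      HilbertGrassmannian.InducedByAntiunitary f by
    refine ⟨?_, h⟩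
    rcases h with ⟨U, hU⟩ | ⟨U, hU⟩
    · exact hU.bijective_of_unitary
    · exact hU.bijective_of_antiunitary
  -- For `k = 0` the Grassmannian is the single point `⊥`, and the identity operator works.
  rcases Nat.eq_zero_or_pos k with rfl | hk0
  · refine Or.inl ⟨LinearIsometryEquiv.refl ℂ H, fun X => ?_⟩
    have hbot : ∀ Y : HilbertGrassmannian 0 H, Y.1 = ⊥ := fun Y => Submodule.finrank_eq_zero.mp Y.2
    rw [hbot, hbot]
    simp
  classical
  let φ : Submodule ℂ H → Submodule ℂ H := fun X =>
    if h : finrank ℂ X = k then (f ⟨X, h⟩).1 else ⊥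
  have hφ : ∀ (X : Submodule ℂ H) (h : finrank ℂ X = k), φ X = (f ⟨X, h⟩).1 := fun X h => dif_pos h
  have hfin : ∀ X : Submodule ℂ H, finrank ℂ X = k → finrank ℂ (φ X) = k := fun X h => by
    rw [hφ X h]
    exact (f ⟨X, h⟩).2
  have hort : ∀ X Y : Submodule ℂ H, finrank ℂ X = k → finrank ℂ Y = k → (X ⟂ Y ↔ φ X ⟂ φ Y) := fun X Y hX hY => by
    rw [hφ X hX, hφ Y hY]
    exact hf ⟨X, hX⟩ ⟨Y, hY⟩
  refine (exists_isometry_of_grassmann_map hort hfin hk0 hk).imp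
    (fun ⟨U, hU⟩ => ⟨U, fun X => ?_⟩) (fun ⟨U, hU⟩ => ⟨U, fun X => ?_⟩)
  · exact (congrArg SetLike.coe (hφ X.1 X.2)).symm.trans
      (coe_eq_image hort hk0 hk (map_add U) U.surjective hU X.2)
  · exact (congrArg SetLike.coe (hφ X.1 X.2)).symm.trans
      (coe_eq_image hort hk0 hk (map_add U) U.surjective hU X.2)
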